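/- Let $1\le d<d'<n$ be integers. For real parameters $t_1<\dots<t_n$ and $e\ge 1$ let $C(n,e)\subset\mathbb R^e$ be the cyclic polytope, the convex hull of the points $v_i=(t_i,t_i^2,\dots,t_i^e)$, $1\le i\le n$, and let $\pi:C(n,d')\to C(n,d)$ be the projection that forgets the last $d'-d$ coordinates. For $t_{n+1}>t_n$ let $C(n+1,e+1)$ be the cyclic polytope with parameters $t_1<\dots<t_{n+1}$, and let $\hat\pi:C(n+1,d'+1)\to C(n+1,d+1)$ be the projection that forgets the last $d'-d$ coordinates. Definitions. For a linear projection of polytopes $\pi:P\to Q=\pi(P)$, a $\pi$-induced subdivision of $Q$ is a family $\mathcal F$ of nonempty faces of $P$ such that $\{\pi(F):F\in\mathcal F\}$ is the set of nonempty cells of a polytopal complex subdividing $Q$, and such that $\pi(F)\subseteq\pi(F')$ implies $F=F'\cap\pi^{-1}(\pi(F))$ for $F,F'\in\mathcal F$. It is $\pi$-coherent if there is a linear functional $f$ such that $\mathcal F$ consists exactly of the inverse images in $P$, under $p\mapsto(\pi(p),f(p))$, of the nonempty lower faces of the polytope $\{(\pi(p),f(p)):p\in P\}$ (a lower face is the set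 of maximizers of a linear functional whose last coordinate is negative). Identify a face of a cyclic polytope with the set of indices $i$ of the points $v_i$ which it contains. A $\hat\pi$-induced subdivision $T'$ of $C(n+1,d+1)$ extends a $\pi$-induced subdivision $T$ of $C(n,d)$ if $T$ is the link of the vertex $n+1$ in $T'$, that is, $T=\{S\subseteq\{1,\dots,n\}: S\ne\emptyset,\ S\cup\{n+1\}\in T'\}$. Proposition. Let $t_1<\dots<t_n$ and let $T$ be a $\pi$-induced subdivision of $C(n,d)$ for $\pi:C(n,d')\to C(n,d)$. (a) If $T$ is $\pi$-coherent, then for every choice of $t_{n+1}>t_n$ there is a $\hat\pi$-induced subdivision $T'$ of $C(n+1,d+1)$ which is $\hat\pi$-coherent and extends $T$. (b) If $T$ is not $\pi$-coherent, then for no choice of $t_{n+1}>t_n$ is there a $\hat\pi$-induced subdivision $T'$ of $C(n+1,d+1)$ which is $\hat\pi$-coherent and extends $T$. -/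

import Mathlib

/-! Cyclic polytopes, subdivisions induced by a projection of polytopes, coherence, links. -/

section Polytopes

variable {E E' : Type*} [AddCommGroup E] [Module ℝ E] [TopologicalSpace E]
  [AddCommGroup E'] [Module ℝ E'] [TopologicalSpace E']

/-- A polytope is the convex hull of finitely many points. -/
def IsPolytope (C : Set E) : Prop :=
  ∃ s : Set E, s.Finite ∧ C = convexHull ℝ s

/-- `F` is a nonempty face of `P`: the set of points of `P` at which some linear functional
attains its maximum over `P` (the zero functional gives `P` itself). -/
def IsFace (P F : Set E) : Prop :=
  F.Nonempty ∧ IsExposed ℝ P F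

/-- `𝒞` is (the set of nonempty cells of) a polytopal complex which subdivides `Q`. -/
structure IsPolytopalSubdivision (Q : Set E) (𝒞 : Set (Set E)) : Prop where
  finite : 𝒞.Finite
  nonempty : ∀ C ∈ 𝒞, C.Nonempty
  polytope : ∀ C ∈ 𝒞, IsPolytope C
  face_mem : ∀ C ∈ 𝒞, ∀ F, IsFace C F → F ∈ 𝒞
  inter : ∀ C ∈ 𝒞, ∀ D ∈ 𝒞, (C ∩ D).Nonempty → IsFace C (C ∩ D) ∧ IsFace D (C ∩ D)
  cover : ⋃₀ 𝒞 = Q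

/-- The family `ℱ` of faces of `P` is (the labelling of) a `π`-induced polytopal subdivision
of `Q`, for a linear map `π` with `π(P) = Q`. -/
structure IsInducedSubdivision (π : E' →ₗ[ℝ] E) (P : Set E') (Q : Set E)
    (ℱ : Set (Set E')) : Prop where
  isFace : ∀ F ∈ ℱ, IsFace P F
  subdivision : IsPolytopalSubdivision Q ((fun F => π '' F) '' ℱ)
  eq_inter : ∀ F ∈ ℱ, ∀ F' ∈ ℱ, π '' F ⊆ π '' F' → F = F' ∩ π ⁻¹' (π '' F)

/-- `G` is a lower face of the polytope `R ⊆ E × ℝ`: its (outer) normal cone contains a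
functional whose last coordinate `c` is negative and for which `G` is exactly the set of
maximizers over `R`. -/
def IsLowerFace (R G : Set (E × ℝ)) : Prop :=
  G.Nonempty ∧ ∃ (l : E →ₗ[ℝ] ℝ) (c : ℝ), c < 0 ∧
    G = {z | z ∈ R ∧ ∀ w ∈ R, l w.1 + c * w.2 ≤ l z.1 + c * z.2}

/-- The family of faces of `P` selected by the functional `f`: the inverse images in `P` of the
lower faces of the lifted polytope `{(π(p), f(p)) : p ∈ P}`. -/
def coherentFamily (π : E' →ₗ[ℝ] E) (P : Set E') (f : E' →ₗ[ℝ] ℝ) : Set (Set E') :=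
  {F | ∃ G, IsLowerFace ((fun p => (π p, f p)) '' P) G ∧ F = P ∩ (fun p => (π p, f p)) ⁻¹' G}

/-- The subdivision labelled by `ℱ` is `π`-coherent: some linear functional on the space of `P`
selects exactly the family `ℱ`. -/
def IsCoherent (π : E' →ₗ[ℝ] E) (P : Set E') (ℱ : Set (Set E')) : Prop :=
  ∃ f : E' →ₗ[ℝ] ℝ, ℱ = coherentFamily π P f

end Polytopes

/-- The point `(t, t², …, t^d)` of the moment curve. -/
def momentPoint (d : ℕ) (t : ℝ) : Fin d → ℝ :=
  fun k => t ^ (k.val + 1)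

/-- The cyclic polytope `C(n, d)` with parameters `t`. -/
def cyclicPolytope (d : ℕ) {n : ℕ} (t : Fin n → ℝ) : Set (Fin d → ℝ) :=
  convexHull ℝ (Set.range fun i => momentPoint d (t i))

/-- The projection `ℝ^{d'} → ℝ^d` which forgets the last `d' - d` coordinates. -/
def forgetLast {d d' : ℕ} (h : d ≤ d') : (Fin d' → ℝ) →ₗ[ℝ] (Fin d → ℝ) :=
  LinearMap.funLeft ℝ ℝ (Fin.castLE h)

/-- The projection maps `C(n, d')` onto `C(n, d)`. -/
theorem forgetLast_image_cyclicPolytope {d d' n : ℕ} (h : d ≤ d') (t : Fin n → ℝ) :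
    forgetLast h '' cyclicPolytope d' t = cyclicPolytope d t := by
  unfold cyclicPolytope
  rw [LinearMap.image_convexHull, ← Set.range_comp]
  rfl

/-- The set of indices of the points `(tᵢ, tᵢ², …, tᵢ^d)` which lie in `F`. -/
def indexSet {d n : ℕ} (t : Fin n → ℝ) (F : Set (Fin d → ℝ)) : Set (Fin n) :=
  {i | momentPoint d (t i) ∈ F}

/-- The link of the last vertex in a family `ℱ` of faces of a cyclic polytope with `n + 1`
vertices: the nonempty sets `S` of remaining indices for which `S` together with the last index
is the index set of a member of `ℱ`. -/
def linkLast {d n : ℕ} (t : Fin (n + 1) → ℝ) (ℱ : Set (Set (Fin d → ℝ))) : Set (Set (Fin n)) :=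
  {S | S.Nonempty ∧ ∃ F ∈ ℱ, indexSet t F = insert (Fin.last n) (Fin.castSucc '' S)}

/-- The subdivision labelled by `ℱ'` (faces of a cyclic polytope with parameters
`t₁, …, tₙ, s`) extends the one labelled by `ℱ` (faces of a cyclic polytope with parameters
`t₁, …, tₙ`): the link of the last vertex in `ℱ'` is `ℱ`, faces being identified with their
index sets. -/
def Extends {d' e' n : ℕ} (t : Fin n → ℝ) (s : ℝ)
    (ℱ' : Set (Set (Fin e' → ℝ))) (ℱ : Set (Set (Fin d' → ℝ))) : Prop :=
  linkLast (Fin.snoc t s : Fin (n + 1) → ℝ) ℱ' = indexSet t '' ℱ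

/-!
Adding a constant to a linear functional on `ℝ^e` and restricting it to the moment curve gives an
arbitrary polynomial of degree at most `e`. So a coherent family on the cyclic polytope is given by
a polynomial `f` of degree at most `d'`, and its members are, as index sets, the nonempty sets of
the form `{i | q(tᵢ) = f(tᵢ)}`, where `q` has degree at most `d` and `q ≤ f` at all the parameters
(`mem_indexSet_image_coherentFamily`).

Let `f'` have degree at most `d' + 1`, and write `f'(x) = (s - x) f(x) + c` with `c = f'(s)`. A
polynomial `q'` of degree at most `d + 1` which agrees with `f'` at `s` has the form
`(s - x) q(x) + c`, and since `s - tᵢ > 0` the inequality `q' ≤ f'` and its equality cases at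
`tᵢ` are those of `q ≤ f`. Hence the link of the last vertex in the family of `f'` is the family of
`f` (`linkLast_coherentFamily`). Both `f ↦ f'` and `f' ↦ f` are available, and faces are determined
by their index sets, so `T` is coherent if and only if it is the link of a coherent family.

For the existence part one also needs that the coherent family of `f'` is an induced subdivision.
This holds for every linear projection `π` of a polytope `P` onto a full-dimensional one
(`isInducedSubdivision_coherentFamily`): cells are the sets on which an affine minorant touches the
lower envelope of `f` over `π(P)`. Supporting hyperplanes of the epigraph of the envelope give a
cell through each interior point of `π(P)`, and finiteness of the family extends the cover to the
boundary. Cyclic polytopes with enough vertices are full-dimensional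
(`interior_cyclicPolytope_nonempty`).
-/

section Coherent

/-! ### Coherent families as contact sets of affine minorants -/

section Algebra

variable {E E' : Type*} [AddCommGroup E] [Module ℝ E] [AddCommGroup E'] [Module ℝ E']

/-- The members of a coherent family are the nonempty contact sets of `f` with the affine
minorants of `f` on `P` that factor through `π`: a lower face with last coordinate `c < 0`
becomes such a minorant on division by `-c`. -/
theorem mem_coherentFamily_iff (π : E' →ₗ[ℝ] E) (P : Set E') (f : E' →ₗ[ℝ] ℝ) (F : Set E') :
    F ∈ coherentFamily π P f ↔ F.Nonempty ∧ ∃ (l : E →ₗ[ℝ] ℝ) (b : ℝ),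
      (∀ p ∈ P, l (π p) + b ≤ f p) ∧ F = {p | p ∈ P ∧ l (π p) + b = f p} := by
  constructor
  · rintro ⟨G, ⟨⟨z, hz⟩, l, c, hc, rfl⟩, rfl⟩
    obtain ⟨⟨p₀, hp₀, rfl⟩, hmax⟩ := hz
    have key : ∀ h m y : ℝ, (-c)⁻¹ * y + (-c)⁻¹ * (-m) ≤ h ↔ y + c * h ≤ m := by
      intro h m y
      rw [← mul_add, inv_mul_le_iff₀ (by linarith)]
      constructor <;> intro _ <;> linarith
    have key' : ∀ h m y : ℝ, (-c)⁻¹ * y + (-c)⁻¹ * (-m) = h ↔ y + c * h = m := by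
      intro h m y
      rw [← mul_add, inv_mul_eq_iff_eq_mul₀ (by linarith)]
      constructor <;> intro _ <;> linarith
    refine ⟨⟨p₀, hp₀, ⟨p₀, hp₀, rfl⟩, hmax⟩, (-c)⁻¹ • l, (-c)⁻¹ * (-(l (π p₀) + c * f p₀)),
      fun p hp => ?_, ?_⟩
    · simp only [LinearMap.smul_apply, smul_eq_mul]
      exact (key _ _ _).2 (hmax _ ⟨p, hp, rfl⟩)
    · ext p
      simp only [LinearMap.smul_apply, smul_eq_mul, Set.mem_inter_iff, Set.mem_preimage,
        Set.mem_ofPred_eq, key']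
      constructor
      · rintro ⟨hp, -, h⟩
        exact ⟨hp, le_antisymm (hmax _ ⟨p, hp, rfl⟩) (h _ ⟨p₀, hp₀, rfl⟩)⟩
      · rintro ⟨hp, h⟩
        exact ⟨hp, ⟨p, hp, rfl⟩, fun w hw => (hmax w hw).trans h.ge⟩
  · rintro ⟨⟨p₀, hp₀⟩, l, b, hle, rfl⟩
    refine ⟨(fun p => (π p, f p)) '' {p | p ∈ P ∧ l (π p) + b = f p},
      ⟨⟨_, p₀, hp₀, rfl⟩, l, -1, by norm_num, ?_⟩, ?_⟩
    · ext z
      constructor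
      · rintro ⟨p, ⟨hp, h⟩, rfl⟩
        refine ⟨⟨p, hp, rfl⟩, ?_⟩
        rintro _ ⟨w, hw, rfl⟩
        have := hle w hw
        simp only
        linarith
      · rintro ⟨⟨p, hp, rfl⟩, h⟩
        refine ⟨p, ⟨hp, le_antisymm (hle p hp) ?_⟩, rfl⟩
        have h1 := h _ ⟨p₀, hp₀.1, rfl⟩
        have h2 := hp₀.2
        simp only at h1
        linarith
    · ext p
      constructor
      · rintro ⟨hp, h⟩
        exact ⟨hp, p, ⟨hp, h⟩, rfl⟩
      · rintro ⟨hp, q, ⟨hq, h⟩, he⟩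
        simp only [Prod.mk.injEq] at he
        refine ⟨hp, ?_⟩
        rw [← he.1, ← he.2, h]

/-- An affine inequality between linear functionals holds on a convex hull as soon as it holds on
the generators. -/
theorem le_of_mem_convexHull_range {ι : Type*} {v : ι → E'} {g : E' →ₗ[ℝ] ℝ} {b : ℝ}
    (hg : ∀ i, g (v i) ≤ b) {p : E'} (hp : p ∈ convexHull ℝ (Set.range v)) : g p ≤ b := by
  have : convexHull ℝ (Set.range v) ⊆ {p | g p ≤ b} :=
    convexHull_min (by rintro _ ⟨i, rfl⟩; exact hg i) (convex_halfSpace_le g.isLinear b)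
  exact this hp

/-- The part of a polytope on a supporting hyperplane is the convex hull of the generators on that
hyperplane. -/
theorem contact_eq_convexHull {ι : Type*} [Finite ι] {v : ι → E'} {g : E' →ₗ[ℝ] ℝ} {b : ℝ}
    (hg : ∀ i, g (v i) ≤ b) :
    {p | p ∈ convexHull ℝ (Set.range v) ∧ g p = b} =
      convexHull ℝ (v '' {i | g (v i) = b}) := by
  cases nonempty_fintype ι
  apply Set.Subset.antisymm
  · rintro p ⟨hp, hpb⟩
    rw [convexHull_range_eq_exists_affineCombination] at hp
    obtain ⟨s, w, hw0, hw1, rfl⟩ := hp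
    rw [Finset.affineCombination_eq_linear_combination _ _ _ hw1] at hpb ⊢
    have hsum : ∑ i ∈ s, w i * (b - g (v i)) = 0 := by
      simp only [mul_sub, Finset.sum_sub_distrib, ← Finset.sum_mul, hw1, ← hpb]
      simp
    have hz := (Finset.sum_eq_zero_iff_of_nonneg
      (fun i hi => mul_nonneg (hw0 i hi) (sub_nonneg.2 (hg i)))).1 hsum
    classical
    rw [← Finset.sum_filter_of_ne (p := fun i => w i ≠ 0)
      (fun i _ h h0 => h (by rw [h0, zero_smul]))]
    refine (convex_convexHull ℝ _).sum_mem (fun i hi => hw0 i (Finset.mem_filter.1 hi).1) ?_ ?_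
    · rw [Finset.sum_filter_ne_zero, hw1]
    · intro i hi
      obtain ⟨his, hi0⟩ := Finset.mem_filter.1 hi
      refine subset_convexHull ℝ _ ⟨i, ?_, rfl⟩
      have := (mul_eq_zero.1 (hz i his)).resolve_left hi0
      simp only [Set.mem_ofPred_eq]
      linarith
  · refine convexHull_min ?_ ((convex_convexHull ℝ _).inter (convex_hyperplane g.isLinear b))
    rintro _ ⟨i, hi, rfl⟩
    exact ⟨subset_convexHull ℝ _ ⟨i, rfl⟩, hi⟩

end Algebra

/-! ### Coherent families are induced subdivisions -/

variable {E E' : Type*} [NormedAddCommGroup E] [NormedSpace ℝ E]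
  [NormedAddCommGroup E'] [NormedSpace ℝ E']

/-- A nonempty face of a polytope is the convex hull of the generators it contains. -/
theorem IsFace.eq_convexHull {ι : Type*} [Finite ι] {v : ι → E'} {F : Set E'}
    (hF : IsFace (convexHull ℝ (Set.range v)) F) : F = convexHull ℝ (v '' {i | v i ∈ F}) := by
  obtain ⟨⟨p₀, hp₀⟩, hexp⟩ := hF
  obtain ⟨g, rfl⟩ := hexp ⟨p₀, hp₀⟩
  obtain ⟨hp₀P, hmax⟩ := hp₀
  have hv : ∀ i, v i ∈ convexHull ℝ (Set.range v) := fun i => subset_convexHull ℝ _ ⟨i, rfl⟩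
  have hiff : ∀ p ∈ convexHull ℝ (Set.range v),
      ((∀ y ∈ convexHull ℝ (Set.range v), g y ≤ g p) ↔ g p = g p₀) := fun p hp =>
    ⟨fun h => le_antisymm (hmax p hp) (h p₀ hp₀P), fun h y hy => h ▸ hmax y hy⟩
  have hL : {p | p ∈ convexHull ℝ (Set.range v) ∧ ∀ y ∈ convexHull ℝ (Set.range v), g y ≤ g p} =
      {p | p ∈ convexHull ℝ (Set.range v) ∧ (g : E' →ₗ[ℝ] ℝ) p = g p₀} := by
    ext p
    exact and_congr_right fun hp => hiff p hp
  have hI : {i | v i ∈ {p | p ∈ convexHull ℝ (Set.range v) ∧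
      ∀ y ∈ convexHull ℝ (Set.range v), g y ≤ g p}} = {i | (g : E' →ₗ[ℝ] ℝ) (v i) = g p₀} := by
    ext i
    exact ⟨fun h => (hiff _ (hv i)).1 h.2, fun h => ⟨hv i, (hiff _ (hv i)).2 h⟩⟩
  rw [hI, hL]
  exact contact_eq_convexHull (g := (g : E' →ₗ[ℝ] ℝ)) fun i => hmax _ (hv i)

theorem isFace_of_mem_coherentFamily [FiniteDimensional ℝ E'] {π : E' →ₗ[ℝ] E} {P : Set E'}
    {f : E' →ₗ[ℝ] ℝ} {F : Set E'} (hF : F ∈ coherentFamily π P f) : IsFace P F := by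
  obtain ⟨⟨p₀, hp₀⟩, l, b, hle, rfl⟩ := (mem_coherentFamily_iff π P f F).1 hF
  refine ⟨⟨p₀, hp₀⟩, fun _ => ⟨LinearMap.toContinuousLinearMap (l.comp π - f), ?_⟩⟩
  ext p
  refine and_congr_right fun hp => ?_
  simp only [LinearMap.coe_toContinuousLinearMap', LinearMap.sub_apply, LinearMap.comp_apply]
  constructor
  · intro h y hy
    linarith [hle y hy]
  · intro h
    have := h p₀ hp₀.1
    have := hp₀.2
    linarith [hle p hp]

/-- A coherent family is finite because its members are determined by the generators of `P` they
contain. -/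
theorem finite_coherentFamily [FiniteDimensional ℝ E'] {ι : Type*} [Finite ι]
    (π : E' →ₗ[ℝ] E) (v : ι → E') (f : E' →ₗ[ℝ] ℝ) : (coherentFamily π (convexHull ℝ (Set.range v)) f).Finite := by
  refine Set.Finite.subset (Set.finite_range fun I : Set ι => convexHull ℝ (v '' I)) ?_
  intro F hF
  exact ⟨_, (isFace_of_mem_coherentFamily hF).eq_convexHull.symm⟩

/-- Two cells meet in a common face: on the first cell the lower envelope of `f` is its affine
minorant `l₁ + b₁`, so the second minorant touches the envelope exactly where `l₂ - l₁` is
maximal. -/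
theorem isFace_inter_of_mem_coherentFamily [FiniteDimensional ℝ E] {π : E' →ₗ[ℝ] E} {P : Set E'}
    {f : E' →ₗ[ℝ] ℝ} {F₁ F₂ : Set E'} (h₁ : F₁ ∈ coherentFamily π P f)
    (h₂ : F₂ ∈ coherentFamily π P f) (hne : (π '' F₁ ∩ π '' F₂).Nonempty) :
    IsFace (π '' F₁) (π '' F₁ ∩ π '' F₂) := by
  obtain ⟨-, l₁, b₁, hle₁, rfl⟩ := (mem_coherentFamily_iff π P f F₁).1 h₁
  obtain ⟨-, l₂, b₂, hle₂, rfl⟩ := (mem_coherentFamily_iff π P f F₂).1 h₂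
  refine ⟨hne, fun _ => ⟨LinearMap.toContinuousLinearMap (l₂ - l₁), ?_⟩⟩
  obtain ⟨x₀, ⟨p₀, ⟨hp₀, e₀⟩, rfl⟩, ⟨q₀, ⟨hq₀, e₀'⟩, hpq⟩⟩ := hne
  have hx₀ : b₁ - b₂ ≤ l₂ (π p₀) - l₁ (π p₀) := by
    have := hle₁ q₀ hq₀
    rw [hpq] at this e₀'
    linarith
  ext x
  simp only [LinearMap.coe_toContinuousLinearMap', LinearMap.sub_apply]
  constructor
  · rintro ⟨⟨p, ⟨hp, e⟩, rfl⟩, ⟨q, ⟨hq, e'⟩, hqp⟩⟩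
    refine ⟨⟨p, ⟨hp, e⟩, rfl⟩, ?_⟩
    rintro _ ⟨y, ⟨hy, ey⟩, rfl⟩
    have h1 := hle₁ q hq
    have h2 := hle₂ y hy
    rw [hqp] at h1 e'
    linarith
  · rintro ⟨⟨p, ⟨hp, e⟩, rfl⟩, h⟩
    refine ⟨⟨p, ⟨hp, e⟩, rfl⟩, p, ⟨hp, ?_⟩, rfl⟩
    have h1 := h _ ⟨p₀, ⟨hp₀, e₀⟩, rfl⟩
    have h2 := hle₂ p hp
    linarith

/-- Every face of a cell is a cell: tilting the affine minorant slightly in the direction that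
exposes the face keeps it below `f` on the finitely many other generators. -/
theorem mem_image_coherentFamily_of_isFace {ι : Type*} [Finite ι] {π : E' →ₗ[ℝ] E} {v : ι → E'}
    {f : E' →ₗ[ℝ] ℝ} {F : Set E'} (hF : F ∈ coherentFamily π (convexHull ℝ (Set.range v)) f)
    {K : Set E} (hK : IsFace (π '' F) K) :
    K ∈ (fun F => π '' F) '' coherentFamily π (convexHull ℝ (Set.range v)) f := by
  obtain ⟨-, l, b, hle, rfl⟩ := (mem_coherentFamily_iff _ _ f F).1 hF
  obtain ⟨⟨x₀, hx₀⟩, hexp⟩ := hK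
  obtain ⟨m, rfl⟩ := hexp ⟨x₀, hx₀⟩
  obtain ⟨⟨p₀, ⟨hp₀, e₀⟩, rfl⟩, hmax⟩ := hx₀
  set M := m (π p₀) with hM
  have hv : ∀ i, v i ∈ convexHull ℝ (Set.range v) := fun i => subset_convexHull ℝ _ ⟨i, rfl⟩
  obtain ⟨ε, hε, hεi⟩ : ∃ ε : ℝ, 0 < ε ∧ ∀ i, l (π (v i)) + b < f (v i) →
      ε * (m (π (v i)) - M) < f (v i) - (l (π (v i)) + b) := by
    have hev : ∀ᶠ ε : ℝ in nhdsWithin 0 (Set.Ioi 0), ∀ i, l (π (v i)) + b < f (v i) →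
        ε * (m (π (v i)) - M) < f (v i) - (l (π (v i)) + b) := by
      rw [Filter.eventually_all]
      intro i
      by_cases hi : l (π (v i)) + b < f (v i)
      · have hc : Filter.Tendsto (fun ε : ℝ => ε * (m (π (v i)) - M)) (nhdsWithin 0 (Set.Ioi 0))
            (nhds (0 * (m (π (v i)) - M))) :=
          (Filter.tendsto_id.mul_const _).mono_left nhdsWithin_le_nhds
        rw [zero_mul] at hc
        filter_upwards [hc.eventually_lt_const (sub_pos.2 hi)] with ε h _ using h
      · exact Filter.Eventually.of_forall fun ε h => absurd h hi
    obtain ⟨ε, h, hpos⟩ := (hev.and self_mem_nhdsWithin).exists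
    exact ⟨ε, hpos, h⟩
  -- The tilted functional `g`: its value at most `c` says that the tilted minorant lies below `f`.
  let g : E' →ₗ[ℝ] ℝ := (l + ε • (m : E →ₗ[ℝ] ℝ)).comp π - f
  have hgdef : ∀ p, g p = l (π p) + ε * m (π p) - f p := fun p => by simp [g]
  have hgi : ∀ i, g (v i) ≤ ε * M - b ∧ (g (v i) = ε * M - b → l (π (v i)) + b = f (v i)) := by
    intro i
    rw [hgdef]
    rcases (hle _ (hv i)).lt_or_eq with h | h
    · have := hεi i h
      exact ⟨by linarith, fun h' => by linarith⟩
    · have := mul_le_mul_of_nonneg_left (hmax _ ⟨v i, ⟨hv i, h⟩, rfl⟩) hε.le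
      exact ⟨by linarith, fun _ => h⟩
  have hgP : ∀ p ∈ convexHull ℝ (Set.range v), g p ≤ ε * M - b := fun p hp =>
    le_of_mem_convexHull_range (fun i => (hgi i).1) hp
  have hcontact : {p | p ∈ convexHull ℝ (Set.range v) ∧ g p = ε * M - b} ⊆
      {p | p ∈ convexHull ℝ (Set.range v) ∧ l (π p) + b = f p} := by
    rw [contact_eq_convexHull fun i => (hgi i).1]
    have hconv : Convex ℝ {p | p ∈ convexHull ℝ (Set.range v) ∧ l (π p) + b = f p} := by
      have h2 : {p | p ∈ convexHull ℝ (Set.range v) ∧ l (π p) + b = f p} =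
          convexHull ℝ (Set.range v) ∩ {p | (f - l.comp π) p = b} := by
        ext p
        refine and_congr_right fun _ => ?_
        simp only [LinearMap.sub_apply, LinearMap.comp_apply, Set.mem_ofPred_eq]
        constructor <;> intro _ <;> linarith
      rw [h2]
      exact (convex_convexHull ℝ _).inter (convex_hyperplane (f - l.comp π).isLinear b)
    refine convexHull_min ?_ hconv
    rintro _ ⟨i, hi, rfl⟩
    exact ⟨hv i, (hgi i).2 hi⟩
  refine ⟨{p | p ∈ convexHull ℝ (Set.range v) ∧ g p = ε * M - b}, ?_, ?_⟩
  · refine (mem_coherentFamily_iff _ _ f _).2 ⟨⟨p₀, hp₀, ?_⟩, l + ε • (m : E →ₗ[ℝ] ℝ),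
      b - ε * M, fun p hp => ?_, ?_⟩
    · rw [hgdef, ← hM]
      linarith
    · have := hgP p hp
      rw [hgdef] at this
      simp
      linarith
    · ext p
      refine and_congr_right fun _ => ?_
      rw [hgdef]
      simp
      constructor <;> intro _ <;> linarith
  · ext x
    constructor
    · rintro ⟨p, hp, rfl⟩
      have hpF := hcontact hp
      refine ⟨⟨p, hpF, rfl⟩, fun y hy => (hmax y hy).trans ?_⟩
      have h1 := hp.2
      have h2 := hpF.2
      rw [hgdef] at h1
      exact (mul_left_cancel₀ hε.ne' (by linarith : ε * M = ε * m (π p))).le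
    · rintro ⟨⟨p, hp, rfl⟩, hx⟩
      refine ⟨p, ⟨hp.1, ?_⟩, rfl⟩
      have h1 : m (π p) = M :=
        le_antisymm (hmax _ ⟨p, hp, rfl⟩) (hx _ ⟨p₀, ⟨hp₀, e₀⟩, rfl⟩)
      rw [hgdef, h1, ← hp.2]
      ring

/-- Over an interior point of `π(P)` there is an affine minorant which touches the lower envelope
of `f` there: a hyperplane supporting the epigraph of the envelope at that point is not
vertical. -/
theorem exists_mem_coherentFamily_of_mem_interior [FiniteDimensional ℝ E'] {π : E' →ₗ[ℝ] E}
    {P : Set E'} (hPc : IsCompact P) (hconv : Convex ℝ P) (f : E' →ₗ[ℝ] ℝ) {x : E}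
    (hx : x ∈ interior (π '' P)) : ∃ F ∈ coherentFamily π P f, x ∈ π '' F := by
  have hπ : Continuous π := π.continuous_of_finiteDimensional
  have hf : Continuous f := f.continuous_of_finiteDimensional
  obtain ⟨q₀, hq₀, hq₀x⟩ := interior_subset hx
  obtain ⟨p₀, ⟨hp₀, hp₀x⟩, hmin⟩ : ∃ p₀ ∈ P ∩ π ⁻¹' {x}, IsMinOn f (P ∩ π ⁻¹' {x}) p₀ :=
    (hPc.inter_right (isClosed_singleton.preimage hπ)).exists_isMinOn
      ⟨q₀, hq₀, hq₀x⟩ hf.continuousOn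
  obtain ⟨p₁, hp₁, hmax⟩ := hPc.exists_isMaxOn ⟨q₀, hq₀⟩ hf.continuousOn
  let K : Set (E × ℝ) := {z | ∃ p ∈ P, π p = z.1 ∧ f p ≤ z.2}
  have hK : Convex ℝ K := by
    rintro z ⟨p, hp, hpz, hfz⟩ w ⟨q, hq, hqw, hfw⟩ a c ha hc hac
    refine ⟨a • p + c • q, hconv hp hq ha hc hac, by simp [hpz, hqw], ?_⟩
    simp only [map_add, map_smul, smul_eq_mul, Prod.snd_add, Prod.smul_snd]
    exact add_le_add (mul_le_mul_of_nonneg_left hfz ha) (mul_le_mul_of_nonneg_left hfw hc)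
  have hsub : interior (π '' P) ×ˢ Set.Ioi (f p₁) ⊆ interior K := by
    refine interior_maximal ?_ (isOpen_interior.prod isOpen_Ioi)
    rintro ⟨y, r⟩ ⟨hy, hr⟩
    obtain ⟨p, hp, rfl⟩ := interior_subset hy
    exact ⟨p, hp, rfl, (hmax hp).trans (le_of_lt hr)⟩
  have htop : (x, f p₁ + 1) ∈ interior K := hsub ⟨hx, by simp⟩
  have hz : (x, f p₀) ∉ interior K := by
    intro h
    have hcont : Filter.Tendsto (fun ε : ℝ => (x, f p₀ - ε)) (nhdsWithin 0 (Set.Ioi 0))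
        (nhds (x, f p₀)) := by
      have : Continuous fun ε : ℝ => (x, f p₀ - ε) := by fun_prop
      have h0 := this.tendsto 0
      simp only [sub_zero] at h0
      exact h0.mono_left nhdsWithin_le_nhds
    obtain ⟨ε, ⟨p, hp, hpx, hfp⟩, hε⟩ :=
      ((hcont.eventually (mem_interior_iff_mem_nhds.1 h)).and self_mem_nhdsWithin).exists
    have h1 : f p₀ ≤ f p := hmin ⟨hp, hpx⟩
    have h2 : (0 : ℝ) < ε := hε
    simp only at hfp
    linarith
  obtain ⟨g, hg⟩ := geometric_hahn_banach_open_point hK.interior isOpen_interior hz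
  have hgK : ∀ z ∈ K, g z ≤ g (x, f p₀) := by
    intro z hzK
    have hcl : z ∈ closure (interior K) := by
      rw [hK.closure_interior_eq_closure_of_nonempty_interior ⟨_, htop⟩]
      exact subset_closure hzK
    exact closure_minimal (fun w hw => (hg w hw).le)
      (isClosed_le g.continuous continuous_const) hcl
  have hsplit : ∀ (y : E) (r : ℝ), g (y, r) = g (y, 0) + g (0, 1) * r := by
    intro y r
    have : (y, r) = (y, (0 : ℝ)) + r • ((0 : E), (1 : ℝ)) := by simp
    rw [this, map_add, map_smul, smul_eq_mul, mul_comm]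
  have hc : g (0, 1) < 0 := by
    have h1 := hg _ htop
    rw [hsplit, hsplit x (f p₀)] at h1
    have h2 : f p₀ ≤ f p₁ := hmax hp₀
    nlinarith
  refine ⟨P ∩ (fun p => (π p, f p)) ⁻¹' {z | z ∈ (fun p => (π p, f p)) '' P ∧
      ∀ w ∈ (fun p => (π p, f p)) '' P,
        (g : E × ℝ →ₗ[ℝ] ℝ).comp (LinearMap.inl ℝ E ℝ) w.1 + g (0, 1) * w.2 ≤
        (g : E × ℝ →ₗ[ℝ] ℝ).comp (LinearMap.inl ℝ E ℝ) z.1 + g (0, 1) * z.2},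
    ⟨_, ⟨?_, _, _, hc, rfl⟩, rfl⟩, ?_⟩
  all_goals
    have hlow : ∀ w ∈ (fun p => (π p, f p)) '' P,
        (g : E × ℝ →ₗ[ℝ] ℝ).comp (LinearMap.inl ℝ E ℝ) w.1 + g (0, 1) * w.2 ≤
        (g : E × ℝ →ₗ[ℝ] ℝ).comp (LinearMap.inl ℝ E ℝ) (π p₀) + g (0, 1) * f p₀ := by
      rintro _ ⟨p, hp, rfl⟩
      have h1 := hgK (π p, f p) ⟨p, hp, rfl, le_rfl⟩
      rw [hsplit, hsplit x (f p₀)] at h1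
      have hp₀x' : π p₀ = x := hp₀x
      simpa [hp₀x'] using h1
  · exact ⟨_, ⟨p₀, hp₀, rfl⟩, hlow⟩
  · exact ⟨p₀, ⟨hp₀, ⟨p₀, hp₀, rfl⟩, hlow⟩, hp₀x⟩

/-- The cells of a coherent family cover `π(P)`: they are finitely many compact sets, and they
cover the interior, which is dense. -/
theorem sUnion_image_coherentFamily [FiniteDimensional ℝ E'] {ι : Type*} [Finite ι]
    (π : E' →ₗ[ℝ] E) (v : ι → E') (f : E' →ₗ[ℝ] ℝ) (hint : (interior (π '' convexHull ℝ (Set.range v))).Nonempty) :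
    ⋃₀ ((fun F => π '' F) '' coherentFamily π (convexHull ℝ (Set.range v)) f) =
      π '' convexHull ℝ (Set.range v) := by
  set P := convexHull ℝ (Set.range v) with hP
  have hPc : IsCompact P := (Set.finite_range v).isCompact_convexHull ℝ
  have hconv : Convex ℝ P := convex_convexHull ℝ _
  apply Set.Subset.antisymm
  · rintro x ⟨_, ⟨F, hF, rfl⟩, hx⟩
    exact Set.image_mono (isFace_of_mem_coherentFamily hF).2.subset hx
  · have hclosed : IsClosed (⋃₀ ((fun F => π '' F) '' coherentFamily π P f)) := by
      rw [Set.sUnion_eq_biUnion]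
      refine ((finite_coherentFamily π v f).image _).isClosed_biUnion ?_
      rintro _ ⟨F, hF, rfl⟩
      rw [(isFace_of_mem_coherentFamily hF).eq_convexHull]
      exact (((Set.toFinite _).isCompact_convexHull ℝ).image
        π.continuous_of_finiteDimensional).isClosed
    have hcl : π '' P ⊆ closure (interior (π '' P)) := by
      rw [(hconv.linear_image π).closure_interior_eq_closure_of_nonempty_interior hint]
      exact subset_closure
    refine hcl.trans (closure_minimal (fun x hx => ?_) hclosed)
    obtain ⟨F, hF, hxF⟩ := exists_mem_coherentFamily_of_mem_interior hPc hconv f hx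
    exact ⟨_, ⟨F, hF, rfl⟩, hxF⟩

/-- Coherent families are induced subdivisions. -/
theorem isInducedSubdivision_coherentFamily [FiniteDimensional ℝ E] [FiniteDimensional ℝ E']
    {ι : Type*} [Finite ι] (π : E' →ₗ[ℝ] E) (v : ι → E') (f : E' →ₗ[ℝ] ℝ) (hint : (interior (π '' convexHull ℝ (Set.range v))).Nonempty) :
    IsInducedSubdivision π (convexHull ℝ (Set.range v)) (π '' convexHull ℝ (Set.range v))
      (coherentFamily π (convexHull ℝ (Set.range v)) f) where
  isFace _ hF := isFace_of_mem_coherentFamily hF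
  subdivision :=
    { finite := (finite_coherentFamily π v f).image _
      nonempty := by
        rintro _ ⟨F, hF, rfl⟩
        exact (isFace_of_mem_coherentFamily hF).1.image π
      polytope := by
        rintro _ ⟨F, hF, rfl⟩
        refine ⟨π '' (v '' {i | v i ∈ F}), Set.toFinite _, ?_⟩
        rw [← π.image_convexHull, ← (isFace_of_mem_coherentFamily hF).eq_convexHull]
      face_mem := by
        rintro _ ⟨F, hF, rfl⟩ K hK
        exact mem_image_coherentFamily_of_isFace hF hK
      inter := by
        rintro _ ⟨F₁, h₁, rfl⟩ _ ⟨F₂, h₂, rfl⟩ hne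
        refine ⟨isFace_inter_of_mem_coherentFamily h₁ h₂ hne, ?_⟩
        rw [Set.inter_comm] at hne
        have := isFace_inter_of_mem_coherentFamily h₂ h₁ hne
        rwa [Set.inter_comm] at this
      cover := sUnion_image_coherentFamily π v f hint }
  eq_inter := by
    intro F₁ h₁ F₂ h₂ hsub
    obtain ⟨-, l₁, b₁, hle₁, rfl⟩ := (mem_coherentFamily_iff _ _ f F₁).1 h₁
    obtain ⟨-, l₂, b₂, hle₂, rfl⟩ := (mem_coherentFamily_iff _ _ f F₂).1 h₂
    ext p
    constructor
    · rintro ⟨hp, e⟩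
      refine ⟨⟨hp, ?_⟩, p, ⟨hp, e⟩, rfl⟩
      obtain ⟨q, ⟨hq, e'⟩, hqp⟩ := hsub ⟨p, ⟨hp, e⟩, rfl⟩
      have h1 := hle₁ q hq
      have h2 := hle₂ p hp
      rw [hqp] at h1 e'
      linarith
    · rintro ⟨⟨hp, e⟩, q, ⟨hq, e'⟩, hqp⟩
      refine ⟨hp, ?_⟩
      have h1 := hle₁ p hp
      have h2 := hle₂ q hq
      rw [hqp] at h2 e'
      linarith

end Coherent

section Cyclic

/-! ### Affine functionals on the moment curve and polynomials -/

open Polynomial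

/-- An affine functional restricts to a polynomial on the moment curve, and its linear part can be
read off from the coefficients. -/
theorem exists_polynomial_of_linearMap {e : ℕ} (l : (Fin e → ℝ) →ₗ[ℝ] ℝ) (b : ℝ) :
    ∃ p : ℝ[X], p.natDegree ≤ e ∧ (∀ k : Fin e, p.coeff (k + 1) = l (Pi.single k 1)) ∧
      ∀ x, p.eval x = l (momentPoint e x) + b := by
  refine ⟨∑ k : Fin e, C (l (Pi.single k 1)) * X ^ (k.val + 1) + C b, ?_, fun k => ?_, fun x => ?_⟩
  · refine natDegree_add_le_of_degree_le (natDegree_sum_le_of_forall_le _ _ fun k _ => ?_)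
      (by simp)
    exact (natDegree_C_mul_X_pow_le _ _).trans k.2
  · simp only [coeff_add, finsetSum_coeff, coeff_C_mul_X_pow, coeff_C_succ, add_zero]
    rw [Finset.sum_eq_single k]
    · simp
    · intro j _ hj
      rw [if_neg]
      intro h
      exact hj (Fin.ext (by omega))
    · simp
  · rw [eval_add, eval_finsetSum, eval_C]
    congr 1
    conv_rhs => rw [← Finset.univ_sum_single (momentPoint e x), map_sum]
    refine Finset.sum_congr rfl fun k _ => ?_
    have hk : (Pi.single k (momentPoint e x k) : Fin e → ℝ) =
        momentPoint e x k • Pi.single k (1 : ℝ) := by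
      rw [← Pi.single_smul, smul_eq_mul, mul_one]
    rw [hk, map_smul, smul_eq_mul, eval_mul, eval_C, eval_pow, eval_X, mul_comm]
    rfl

theorem exists_linearMap_of_polynomial {e : ℕ} (p : ℝ[X]) (hp : p.natDegree ≤ e) :
    ∃ l : (Fin e → ℝ) →ₗ[ℝ] ℝ, ∀ x, p.eval x = l (momentPoint e x) + p.coeff 0 := by
  refine ⟨∑ k : Fin e, p.coeff (k + 1) • LinearMap.proj k, fun x => ?_⟩
  rw [eval_eq_sum_range' (Nat.lt_succ_of_le hp), Finset.sum_range_succ', ← Fin.sum_univ_eq_sum_range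
    (fun k => p.coeff (k + 1) * x ^ (k + 1)) e]
  simp [momentPoint]

theorem natDegree_C_sub_X_mul_le (s : ℝ) (p : ℝ[X]) :
    ((C s - X) * p).natDegree ≤ p.natDegree + 1 := by
  refine natDegree_mul_le.trans ?_
  rw [← neg_sub, natDegree_neg, natDegree_X_sub_C, add_comm]

theorem forgetLast_momentPoint {d d' : ℕ} (h : d ≤ d') (x : ℝ) :
    forgetLast h (momentPoint d' x) = momentPoint d x :=
  rfl

/-- A cyclic polytope with more vertices than its dimension is full-dimensional: an affine
functional vanishing at all its vertices is a polynomial with too many roots. -/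
theorem interior_cyclicPolytope_nonempty {d n : ℕ} (hdn : d < n) {t : Fin n → ℝ}
    (ht : Function.Injective t) : (interior (cyclicPolytope d t)).Nonempty := by
  have hne : (Set.range fun i => momentPoint d (t i)).Nonempty := ⟨_, ⟨0, by omega⟩, rfl⟩
  rw [cyclicPolytope, interior_convexHull_nonempty_iff_affineSpan_eq_top,
    AffineSubspace.affineSpan_eq_top_iff_vectorSpan_eq_top_of_nonempty _ _ _ hne]
  by_contra hV
  obtain ⟨l, hl0, hl⟩ := Submodule.exists_le_ker_of_lt_top _ (lt_top_iff_ne_top.2 hV)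
  let i₀ : Fin n := ⟨0, by omega⟩
  obtain ⟨p, hdeg, hcoeff, heval⟩ :=
    exists_polynomial_of_linearMap l (-l (momentPoint d (t i₀)))
  have hroot : ∀ i, p.eval (t i) = 0 := by
    intro i
    have : l (momentPoint d (t i) -ᵥ momentPoint d (t i₀)) = 0 :=
      hl (vsub_mem_vectorSpan ℝ ⟨i, rfl⟩ ⟨i₀, rfl⟩)
    rw [vsub_eq_sub, map_sub] at this
    rw [heval]
    linarith
  have hp : p = 0 := by
    refine eq_zero_of_natDegree_lt_card_of_eval_eq_zero p ht hroot ?_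
    rw [Fintype.card_fin]
    omega
  apply hl0
  refine LinearMap.pi_ext' fun k => LinearMap.ext_ring ?_
  have := hcoeff k
  rw [hp, coeff_zero] at this
  simpa using this.symm

/-! ### Index sets and links -/

/-- The faces of a cyclic polytope are determined by their index sets. -/
theorem eq_of_indexSet_eq {d n : ℕ} {t : Fin n → ℝ} {F G : Set (Fin d → ℝ)}
    (hF : IsFace (cyclicPolytope d t) F) (hG : IsFace (cyclicPolytope d t) G)
    (h : indexSet t F = indexSet t G) : F = G := by
  rw [hF.eq_convexHull, hG.eq_convexHull]
  exact congrArg (fun I => convexHull ℝ ((fun i => momentPoint d (t i)) '' I)) h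

/-- The index sets of a coherent family on a cyclic polytope are the nonempty sets on which a
polynomial of degree at most `d`, lying below `f` at all parameters, agrees with `f`. -/
theorem mem_indexSet_image_coherentFamily {d d' n : ℕ} (h : d ≤ d') (t : Fin n → ℝ)
    (f : (Fin d' → ℝ) →ₗ[ℝ] ℝ) (S : Set (Fin n)) :
    S ∈ indexSet t '' coherentFamily (forgetLast h) (cyclicPolytope d' t) f ↔
      S.Nonempty ∧ ∃ q : ℝ[X], q.natDegree ≤ d ∧
        (∀ i, q.eval (t i) ≤ f (momentPoint d' (t i))) ∧
        S = {i | q.eval (t i) = f (momentPoint d' (t i))} := by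
  have hv : ∀ i, momentPoint d' (t i) ∈ cyclicPolytope d' t :=
    fun i => subset_convexHull ℝ _ ⟨i, rfl⟩
  constructor
  · rintro ⟨F, hF, rfl⟩
    refine ⟨?_, ?_⟩
    · have hFace := isFace_of_mem_coherentFamily hF
      by_contra hS
      have h1 := hFace.eq_convexHull
      have h2 : {i | momentPoint d' (t i) ∈ F} = ∅ := Set.not_nonempty_iff_eq_empty.1 hS
      rw [h2, Set.image_empty, convexHull_empty] at h1
      exact hFace.1.ne_empty h1
    · obtain ⟨-, l, b, hle, rfl⟩ := (mem_coherentFamily_iff _ _ f F).1 hF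
      obtain ⟨q, hq, -, he⟩ := exists_polynomial_of_linearMap l b
      refine ⟨q, hq, fun i => ?_, ?_⟩
      · rw [he]
        exact hle _ (hv i)
      · ext i
        simp only [he]
        exact ⟨fun hi => hi.2, fun hi => ⟨hv i, hi⟩⟩
  · rintro ⟨⟨i₀, hi₀⟩, q, hq, hle, rfl⟩
    obtain ⟨l, hl⟩ := exists_linearMap_of_polynomial q hq
    simp only [hl] at hle hi₀ ⊢
    refine ⟨{p | p ∈ cyclicPolytope d' t ∧ l (forgetLast h p) + q.coeff 0 = f p},
      (mem_coherentFamily_iff _ _ f _).2 ⟨⟨_, hv i₀, hi₀⟩, l, q.coeff 0, fun p hp => ?_, rfl⟩, ?_⟩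
    · have := le_of_mem_convexHull_range (g := l.comp (forgetLast h) - f) (b := -q.coeff 0)
        (fun i => by
          have := hle i
          simp only [LinearMap.sub_apply, LinearMap.comp_apply, forgetLast_momentPoint]
          linarith) hp
      simp only [LinearMap.sub_apply, LinearMap.comp_apply] at this
      linarith
    · ext i
      exact ⟨fun hi => hi.2, fun hi => ⟨hv i, hi⟩⟩

/-- If `f'(x) = (s - x) (f(x) + a) + c` along the moment curve, the link of the vertex with
parameter `s` in the coherent family of `f'` is the coherent family of `f`: a polynomial that
meets `f'` at `s` is `(s - x) q(x) + c`, and `s - x` is positive at the other parameters. -/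
theorem linkLast_coherentFamily {d d' n : ℕ} (h : d ≤ d') (h' : d + 1 ≤ d' + 1) {t : Fin n → ℝ}
    {s : ℝ} (hs : ∀ i, t i < s) (f : (Fin d' → ℝ) →ₗ[ℝ] ℝ) (f' : (Fin (d' + 1) → ℝ) →ₗ[ℝ] ℝ)
    (a c : ℝ) (hf : ∀ x, f' (momentPoint (d' + 1) x) = (s - x) * (f (momentPoint d' x) + a) + c) :
    linkLast (Fin.snoc t s : Fin (n + 1) → ℝ) (coherentFamily (forgetLast h')
        (cyclicPolytope (d' + 1) (Fin.snoc t s : Fin (n + 1) → ℝ)) f') =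
      indexSet t '' coherentFamily (forgetLast h) (cyclicPolytope d' t) f := by
  ext S
  rw [mem_indexSet_image_coherentFamily]
  refine and_congr_right fun hS => ?_
  change insert (Fin.last n) (Fin.castSucc '' S) ∈ indexSet (Fin.snoc t s : Fin (n + 1) → ℝ) ''
    coherentFamily _ _ f' ↔ _
  rw [mem_indexSet_image_coherentFamily, and_iff_right (Set.insert_nonempty _ _)]
  have hpos : ∀ i, 0 < s - t i := fun i => sub_pos.2 (hs i)
  have hmem : ∀ i : Fin n, i.castSucc ∈ insert (Fin.last n) (Fin.castSucc '' S) ↔ i ∈ S := by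
    intro i
    rw [Set.mem_insert_iff, (Fin.castSucc_injective n).mem_set_image]
    exact or_iff_right i.castSucc_ne_last
  constructor
  · rintro ⟨q', hdeg, hle, hI⟩
    have hlast : q'.eval s = c := by
      have h1 : Fin.last n ∈ insert (Fin.last n) (Fin.castSucc '' S) := Set.mem_insert _ _
      rw [hI] at h1
      simpa [hf] using h1
    obtain ⟨r, hr⟩ : X - C s ∣ q' - C c := dvd_iff_isRoot.2 (by simp [hlast])
    have hq' : ∀ x, q'.eval x = (s - x) * (-r).eval x + c := by
      intro x
      have := congrArg (eval x) hr
      simp at this ⊢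
      linarith
    have hdr : r.natDegree ≤ d := by
      by_cases hr0 : r = 0
      · simp [hr0]
      · have h1 : (q' - C c).natDegree ≤ d + 1 := by simpa using hdeg
        rw [hr, natDegree_mul (X_sub_C_ne_zero s) hr0, natDegree_X_sub_C] at h1
        omega
    refine ⟨-r + C (-a), ?_, fun i => ?_, ?_⟩
    · rw [natDegree_add_C, natDegree_neg]
      exact hdr
    · have h1 := hle i.castSucc
      simp only [Fin.snoc_castSucc, hf, hq'] at h1
      have := le_of_mul_le_mul_left (le_of_add_le_add_right h1) (hpos i)
      simp only [eval_add, eval_C]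
      linarith
    · ext i
      rw [← hmem i, hI]
      simp only [Set.mem_ofPred_eq, Fin.snoc_castSucc, hf, hq', add_left_inj,
        mul_right_inj' (hpos i).ne', eval_add, eval_C]
      constructor <;> intro _ <;> linarith
  · rintro ⟨q, hdeg, hle, rfl⟩
    refine ⟨(C s - X) * (q + C a) + C c, ?_, fun i => ?_, ?_⟩
    · rw [natDegree_add_C]
      refine (natDegree_C_sub_X_mul_le s _).trans ?_
      rw [natDegree_add_C]
      omega
    · refine Fin.lastCases ?_ (fun i => ?_) i
      · simp [hf]
      · simp only [Fin.snoc_castSucc, hf, eval_add, eval_mul, eval_sub, eval_C, eval_X]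
        have := mul_le_mul_of_nonneg_left (hle i) (hpos i).le
        linarith
    · ext i
      refine Fin.lastCases ?_ (fun i => ?_) i
      · simp [hf]
      · rw [hmem]
        simp [Fin.snoc_castSucc, hf, (hpos i).ne']

/-- Along the moment curve, `s - x` times a linear functional on `ℝ^e` is an affine functional on
`ℝ^{e + 1}`. -/
theorem exists_linearMap_eq_sub_mul {e : ℕ} (s : ℝ) (f : (Fin e → ℝ) →ₗ[ℝ] ℝ) :
    ∃ (f' : (Fin (e + 1) → ℝ) →ₗ[ℝ] ℝ) (c : ℝ),
      ∀ x, f' (momentPoint (e + 1) x) = (s - x) * f (momentPoint e x) + c := by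
  obtain ⟨p, hp, -, hpe⟩ := exists_polynomial_of_linearMap f 0
  have hdeg : ((C s - X) * p).natDegree ≤ e + 1 :=
    (natDegree_C_sub_X_mul_le s p).trans (Nat.succ_le_succ hp)
  obtain ⟨f', hf'⟩ := exists_linearMap_of_polynomial _ hdeg
  refine ⟨f', -((C s - X) * p).coeff 0, fun x => ?_⟩
  have := hf' x
  rw [eval_mul, hpe] at this
  simp only [eval_sub, eval_C, eval_X] at this
  linarith

/-- Along the moment curve, every linear functional on `ℝ^{e + 1}` is, up to a constant, the product
of `s - x` and an affine functional on `ℝ^e`. -/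
theorem exists_sub_mul_eq_linearMap {e : ℕ} (s : ℝ) (f' : (Fin (e + 1) → ℝ) →ₗ[ℝ] ℝ) :
    ∃ (f : (Fin e → ℝ) →ₗ[ℝ] ℝ) (a c : ℝ),
      ∀ x, f' (momentPoint (e + 1) x) = (s - x) * (f (momentPoint e x) + a) + c := by
  obtain ⟨p, hp, -, hpe⟩ := exists_polynomial_of_linearMap f' 0
  obtain ⟨r, hr⟩ : X - C s ∣ p - C (p.eval s) := dvd_iff_isRoot.2 (by simp)
  have hdr : (-r).natDegree ≤ e := by
    rw [natDegree_neg]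
    by_cases hr0 : r = 0
    · simp [hr0]
    · have h1 : (p - C (p.eval s)).natDegree ≤ e + 1 := by simpa using hp
      rw [hr, natDegree_mul (X_sub_C_ne_zero s) hr0, natDegree_X_sub_C] at h1
      omega
  obtain ⟨f, hf⟩ := exists_linearMap_of_polynomial _ hdr
  refine ⟨f, (-r).coeff 0, p.eval s, fun x => ?_⟩
  have h1 := congrArg (eval x) hr
  have h2 := hpe x
  rw [← hf, eval_neg]
  simp only [eval_sub, eval_mul, eval_C, eval_X] at h1
  linarith

end Cyclic

theorem mainTheorem8 (n d d' : ℕ) (hd : 1 ≤ d) (hdd' : d < d') (hn : d' < n)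
    (t : Fin n → ℝ) (ht : StrictMono t) (T : Set (Set (Fin d' → ℝ)))
    (hT : IsInducedSubdivision (forgetLast hdd'.le) (cyclicPolytope d' t)
      (cyclicPolytope d t) T) :
    (IsCoherent (forgetLast hdd'.le) (cyclicPolytope d' t) T →
      ∀ s : ℝ, (∀ i, t i < s) →
        ∃ T' : Set (Set (Fin (d' + 1) → ℝ)),
          IsInducedSubdivision (forgetLast (Nat.succ_le_succ hdd'.le))
            (cyclicPolytope (d' + 1) (Fin.snoc t s : Fin (n + 1) → ℝ))
            (cyclicPolytope (d + 1) (Fin.snoc t s : Fin (n + 1) → ℝ)) T' ∧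
          IsCoherent (forgetLast (Nat.succ_le_succ hdd'.le))
            (cyclicPolytope (d' + 1) (Fin.snoc t s : Fin (n + 1) → ℝ)) T' ∧
          Extends t s T' T) ∧
    (¬ IsCoherent (forgetLast hdd'.le) (cyclicPolytope d' t) T →
      ∀ s : ℝ, (∀ i, t i < s) →
        ¬ ∃ T' : Set (Set (Fin (d' + 1) → ℝ)),
          IsInducedSubdivision (forgetLast (Nat.succ_le_succ hdd'.le))
            (cyclicPolytope (d' + 1) (Fin.snoc t s : Fin (n + 1) → ℝ))
            (cyclicPolytope (d + 1) (Fin.snoc t s : Fin (n + 1) → ℝ)) T' ∧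
          IsCoherent (forgetLast (Nat.succ_le_succ hdd'.le))
            (cyclicPolytope (d' + 1) (Fin.snoc t s : Fin (n + 1) → ℝ)) T' ∧
          Extends t s T' T) := by
  refine ⟨?_, ?_⟩
  · rintro ⟨f, rfl⟩ s hs
    obtain ⟨f', c, hf'⟩ := exists_linearMap_eq_sub_mul s f
    have hinj : Function.Injective (Fin.snoc t s : Fin (n + 1) → ℝ) := by
      rw [Fin.snoc_injective_iff]
      exact ⟨ht.injective, fun ⟨i, hi⟩ => (hs i).ne hi⟩
    refine ⟨_, ?_, ⟨f', rfl⟩, linkLast_coherentFamily hdd'.le _ hs f f' 0 c (by simpa using hf')⟩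
    have hint := interior_cyclicPolytope_nonempty (d := d + 1) (by omega) hinj
    rw [← forgetLast_image_cyclicPolytope (Nat.succ_le_succ hdd'.le)] at hint ⊢
    exact isInducedSubdivision_coherentFamily _ _ f' hint
  · rintro hT' s hs ⟨_, -, ⟨f', rfl⟩, hext⟩
    obtain ⟨f, a, c, hf⟩ := exists_sub_mul_eq_linearMap s f'
    refine hT' ⟨f, ?_⟩
    have himg : indexSet t '' T =
        indexSet t '' coherentFamily (forgetLast hdd'.le) (cyclicPolytope d' t) f :=
      hext.symm.trans (linkLast_coherentFamily hdd'.le _ hs f f' a c hf)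
    ext F
    constructor
    · intro hF
      obtain ⟨G, hG, hGF⟩ := himg ▸ Set.mem_image_of_mem (indexSet t) hF
      rwa [← eq_of_indexSet_eq (isFace_of_mem_coherentFamily hG) (hT.isFace F hF) hGF]
    · intro hF
      obtain ⟨G, hG, hGF⟩ := himg.symm ▸ Set.mem_image_of_mem (indexSet t) hF
      rwa [← eq_of_indexSet_eq (hT.isFace G hG) (isFace_of_mem_coherentFamily hF) hGF]
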